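/- A polymatroid game consists of a finite set $N$ of $n$ players and a finite set $E$ of $m$ resources and, for every player $i\in N$, a demand $d_i\in\mathbb N=\{0,1,2,\dots\}$, an integral polymatroid rank function $f_i:2^E\to\mathbb N$ (normalized, monotone and submodular) with $d_i\le f_i(E)$, and functions $C_{i,e}:\mathbb N\times\mathbb N\to\mathbb R$, $e\in E$. Write $C^-(x;t)=C(x;t)-C(x-1;t)$ for $x\ge 1$; every $C=C_{i,e}$ is assumed to be regular, that is, $C^-(x;t)\le C^-(x;t+1)\le C^-(x+1;t)$ for all integers $x\ge 1$ and $t\ge 0$. For $k\in\mathbb N$ let $$X_i(k)=\Bigl\{x\in\mathbb N^E : \sum_{e\in U}x_e\le f_i(U)\text{ for all }U\subseteq E,\ \sum_{e\in E}x_e=k\Bigr\}.$$ The strategies of player $i$ are the elements of $X_i(d_i)$, and the private cost of player $i$ under a profile $x=(x_i)_{i\in N}$ is $\pi_i(x)=\sum_{e\in E}C_{i,e}\bigl(x_{i,e};\sum_{j\ne i}x_{j,e}\bigr)$. Consider the following algorithm, in which $\|\cdot\|$ is the $L_1$-norm and all choices are arbitrary. Start with $\bar d_i=0$ and $x_i=0$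 for all $i\in N$. For $k=1,\dots,\sum_{i\in N} d_i$: choose a player $i$ with $\bar d_i<d_i$, increase $\bar d_i$ by one, and replace $x_i$ by a best response $y_i\in X_i(\bar d_i)$ with $\|y_i-x_i\|=1$; then, while some player $i$ can strictly decrease its private cost by switching to another strategy in $X_i(\bar d_i)$, choose such a player $i$ and replace $x_i$ by a best response $y_i\in X_i(\bar d_i)$ with $\|y_i-x_i\|=2$. Finally return $x$. Then, for all possible choices, the best responses required by the algorithm always exist, the algorithm returns a pure Nash equilibrium of the game, and the total number of iterations (of the for-loop and of the while-loop together) is at most $n^2m\delta^3$, where $\delta=\max_{i\in N}d_i$ (and $\delta=0$ if $N=\emptyset$). -/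

import Mathlib

/-- Integral polymatroid rank functions: normalized, monotone, submodular, with values in `ℕ`. -/
structure IsIntegralPolymatroidRank {E : Type*} [DecidableEq E] (f : Finset E → ℕ) : Prop where
  normalized : f ∅ = 0
  monotone : ∀ U V : Finset E, U ⊆ V → f U ≤ f V
  submodular : ∀ U V : Finset E, f (U ∪ V) + f (U ∩ V) ≤ f U + f V

/-- The integral polymatroid base polyhedron of `f`, truncated at `d`. -/
def polymatroidBase {E : Type*} [Fintype E] (f : Finset E → ℕ) (d : ℕ) : Set (E → ℕ) :=
  {x | (∀ U : Finset E, ∑ e ∈ U, x e ≤ f U) ∧ ∑ e, x e = d}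

/-- The left discrete derivative in the first argument, `C (x; t) - C (x - 1; t)`. It is
meaningful for `1 ≤ x` only, and is only used for such `x`. -/
def leftDeriv (C : ℕ → ℕ → ℝ) (x t : ℕ) : ℝ := C x t - C (x - 1) t

/-- Regularity of a cost function `C (x; t)`. -/
structure IsRegularCost (C : ℕ → ℕ → ℝ) : Prop where
  mono : ∀ x t : ℕ, 1 ≤ x → leftDeriv C x t ≤ leftDeriv C x (t + 1)
  shift : ∀ x t : ℕ, 1 ≤ x → leftDeriv C x (t + 1) ≤ leftDeriv C (x + 1) t

/-- The `L₁` distance of two integral vectors. -/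
def l1Dist {E : Type*} [Fintype E] (x y : E → ℕ) : ℤ := ∑ e, |(x e : ℤ) - (y e : ℤ)|

/-- A polymatroid game with player set `N` and resource set `E`: demands `d i`, capacity functions
`f i` and costs `C i e x t`, where `x` is the player's own load and `t` the load of the others. -/
structure PolymatroidGame (N E : Type*) [Fintype N] [Fintype E] [DecidableEq E] where
  d : N → ℕ
  f : N → Finset E → ℕ
  C : N → E → ℕ → ℕ → ℝ
  rank_f : ∀ i, IsIntegralPolymatroidRank (f i)
  d_le : ∀ i, d i ≤ f i Finset.univ
  regular_C : ∀ i e, IsRegularCost (C i e)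

namespace PolymatroidGame

variable {N E : Type*} [Fintype N] [DecidableEq N] [Fintype E] [DecidableEq E]

/-- The load on `e` caused by the players other than `i`. -/
def othersLoad (x : N → E → ℕ) (i : N) (e : E) : ℕ := ∑ j ∈ Finset.univ.erase i, x j e

/-- The private cost of player `i` under the strategy profile `x`. -/
def privateCost (G : PolymatroidGame N E) (i : N) (x : N → E → ℕ) : ℝ :=
  ∑ e, G.C i e (x i e) (othersLoad x i e)

/-- `y` is a best response of player `i` to the strategies of the others in `x`, when the demand
of player `i` is `k`. -/
def IsBestResponse (G : PolymatroidGame N E) (i : N) (k : ℕ) (x : N → E → ℕ) (y : E → ℕ) : Prop :=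
  y ∈ polymatroidBase (G.f i) k ∧
    ∀ z ∈ polymatroidBase (G.f i) k,
      G.privateCost i (Function.update x i y) ≤ G.privateCost i (Function.update x i z)

/-- `x` is a pure Nash equilibrium of the game. -/
def IsPureNash (G : PolymatroidGame N E) (x : N → E → ℕ) : Prop :=
  ∀ i, G.IsBestResponse i (G.d i) x (x i)

/-- The variables of the algorithm: the preliminary demands and the preliminary strategies. -/
structure State (N E : Type*) where
  dbar : N → ℕ
  x : N → E → ℕ

/-- In the state `s`, player `i` can improve in the game with the preliminary demands. -/
def CanImprove (G : PolymatroidGame N E) (s : State N E) (i : N) : Prop :=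
  ∃ z ∈ polymatroidBase (G.f i) (s.dbar i),
    G.privateCost i (Function.update s.x i z) < G.privateCost i s.x

/-- Head of the body of the for-loop: the preliminary demand of a player `i` that is still below
its demand is increased by one, and `i` switches to a best response at distance one. -/
def IncreaseStep (G : PolymatroidGame N E) (i : N) (s s' : State N E) : Prop :=
  s.dbar i < G.d i ∧ ∃ y : E → ℕ,
    G.IsBestResponse i (s.dbar i + 1) s.x y ∧ l1Dist y (s.x i) = 1 ∧
    s' = ⟨Function.update s.dbar i (s.dbar i + 1), Function.update s.x i y⟩

/-- An iteration of the while-loop: a player `i` that can improve switches to a best response at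
distance two. -/
def ImproveStep (G : PolymatroidGame N E) (i : N) (s s' : State N E) : Prop :=
  G.CanImprove s i ∧ ∃ y : E → ℕ,
    G.IsBestResponse i (s.dbar i) s.x y ∧ l1Dist y (s.x i) = 2 ∧
    s' = ⟨s.dbar, Function.update s.x i y⟩

/-- `G.Run k l s`: some execution of the algorithm (with arbitrary choices of the players and of
the best responses) reaches the state `s` after having started exactly `k` iterations of the
for-loop and having completed, in total, exactly `l` iterations of the while-loop. A new iteration
of the for-loop starts only after the while-loop is left, that is, when nobody can improve. -/
inductive Run (G : PolymatroidGame N E) : ℕ → ℕ → State N E → Prop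
  | init : Run G 0 0 ⟨fun _ => 0, fun _ _ => 0⟩
  | increase {k l : ℕ} {s s' : State N E} (i : N) : Run G k l s → (∀ j, ¬ G.CanImprove s j) →
      k < ∑ j, G.d j → G.IncreaseStep i s s' → Run G (k + 1) l s'
  | improve {k l : ℕ} {s s' : State N E} (i : N) : Run G k l s →
      G.ImproveStep i s s' → Run G k (l + 1) s'

end PolymatroidGame

/-! Call the span between two increases of a demand a phase, and let `L` be the total loads of the
equilibrium reached before it. Throughout the phase the loads are `L` plus one unit on a single
resource `r`. The invariant is that every player is stable with respect to `L` (`IsStable`), a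
condition that does not involve the other strategies. By regularity, a player can then gain only by
taking a unit off `r`. A best response at distance two does so, moves the surplus unit to another
resource `b` and preserves stability (`IsStable.of_optimal_transfer`).

Such a best response exists: local optimality over a polymatroid base is global
(`cost_le_of_forall_transfer`), and the cheapest feasible target of a unit from `r` gives a local
optimum (`IsStable.exists_optimal_transfer`). Both rest on the symmetric exchange property. For an
increase of the demand, the cheapest feasible added unit is optimal (`exists_optimal_extension`).

For termination, price each unit on `e` at total load `L e + 1`. As `L` is frozen, a move replaces
one price by a strictly smaller one. Each player has at most `mδ` prices, so the sum of the ranks of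
at most `nδ` units bounds a phase by `nδ(mδ - 1)` improvements, and there are at most `nδ` phases.
-/

section Polymatroid

/-! ### Transfers, tight sets and exchange in integral polymatroids. -/

variable {E : Type*} [Fintype E] [DecidableEq E]

/-- `y` arises from `x` by moving one unit from `a` to `b`. -/
def IsTransfer (x y : E → ℕ) (a b : E) : Prop :=
  ∀ e, y e + (if e = a then 1 else 0) = x e + (if e = b then 1 else 0)

omit [Fintype E] in
theorem IsTransfer.source {x y : E → ℕ} {a b : E} (h : IsTransfer x y a b) (hab : a ≠ b) :
    y a + 1 = x a := by
  simpa [hab] using h a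

omit [Fintype E] in
theorem IsTransfer.target {x y : E → ℕ} {a b : E} (h : IsTransfer x y a b) (hab : a ≠ b) :
    y b = x b + 1 := by
  simpa [hab.symm] using h b

omit [Fintype E] in
theorem IsTransfer.other {x y : E → ℕ} {a b e : E} (h : IsTransfer x y a b) (ha : e ≠ a)
    (hb : e ≠ b) : y e = x e := by
  simpa [ha, hb] using h e

omit [Fintype E] in
theorem IsTransfer.source_pos {x y : E → ℕ} {a b : E} (h : IsTransfer x y a b)
    (hab : a ≠ b) : 1 ≤ x a := by
  have := h.source hab
  omega

omit [Fintype E] in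
theorem exists_isTransfer {x : E → ℕ} {a : E} (b : E) (ha : 0 < x a) :
    ∃ y, IsTransfer x y a b := by
  refine ⟨fun e => x e + (if e = b then 1 else 0) - (if e = a then 1 else 0), fun e => ?_⟩
  rcases eq_or_ne e a with rfl | h
  · simp only [if_true]
    omega
  · simp [h]

omit [Fintype E] in
theorem IsTransfer.sum_eq {x y : E → ℕ} {a b : E} (h : IsTransfer x y a b) (U : Finset E) :
    ∑ e ∈ U, y e + (if a ∈ U then 1 else 0) = ∑ e ∈ U, x e + (if b ∈ U then 1 else 0) := by
  have := Finset.sum_congr rfl fun e (_ : e ∈ U) => h e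
  simpa [Finset.sum_add_distrib] using this

theorem IsTransfer.sum_apply_add {M : Type*} [AddCommMonoid M] {x y : E → ℕ} {a b : E}
    (h : IsTransfer x y a b) (hab : a ≠ b) (F : E → ℕ → M) :
    ∑ e, F e (y e) + (F a (x a) + F b (x b)) = ∑ e, F e (x e) + (F a (y a) + F b (y b)) := by
  have split (w : E → ℕ) : ∑ e, F e (w e) =
      ∑ e ∈ (Finset.univ.erase a).erase b, F e (w e) + (F b (w b) + F a (w a)) := by
    rw [← add_assoc, Finset.sum_erase_add _ _ (by simp [hab.symm]),
      Finset.sum_erase_add _ _ (by simp)]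
  have rest : ∑ e ∈ (Finset.univ.erase a).erase b, F e (y e) =
      ∑ e ∈ (Finset.univ.erase a).erase b, F e (x e) := by
    refine Finset.sum_congr rfl fun e he => ?_
    simp only [Finset.mem_erase, Finset.mem_univ, and_true] at he
    rw [h.other he.2 he.1]
  rw [split x, split y, rest]
  abel

-- Truncation makes the ground set tight for every base, so that tight sets of a base are closed
-- under arbitrary intersections, including the empty one.
omit [Fintype E] in
theorem IsIntegralPolymatroidRank.truncate {f : Finset E → ℕ} (hf : IsIntegralPolymatroidRank f)
    (d : ℕ) : IsIntegralPolymatroidRank fun U => min (f U) d where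
  normalized := by simp [hf.normalized]
  monotone U V h := min_le_min_right d (hf.monotone U V h)
  submodular U V := by
    have h1 := hf.submodular U V
    have h2 := hf.monotone _ _ (Finset.subset_union_left : U ⊆ U ∪ V)
    have h3 := hf.monotone _ _ (Finset.subset_union_right : V ⊆ U ∪ V)
    have h4 := hf.monotone _ _ (Finset.inter_subset_left : U ∩ V ⊆ U)
    have h5 := hf.monotone _ _ (Finset.inter_subset_right : U ∩ V ⊆ V)
    omega

omit [Fintype E] in
theorem IsIntegralPolymatroidRank.tight_union_inter {f : Finset E → ℕ}
    (hf : IsIntegralPolymatroidRank f) {x : E → ℕ} (hx : ∀ U, ∑ e ∈ U, x e ≤ f U)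
    {S T : Finset E} (hS : ∑ e ∈ S, x e = f S) (hT : ∑ e ∈ T, x e = f T) :
    ∑ e ∈ S ∪ T, x e = f (S ∪ T) ∧ ∑ e ∈ S ∩ T, x e = f (S ∩ T) := by
  have h1 := Finset.sum_union_inter (s₁ := S) (s₂ := T) (f := x)
  have h2 := hf.submodular S T
  have h3 := hx (S ∪ T)
  have h4 := hx (S ∩ T)
  omega

omit [Fintype E] in
theorem IsIntegralPolymatroidRank.tight_sup {f : Finset E → ℕ}
    (hf : IsIntegralPolymatroidRank f) {x : E → ℕ} (hx : ∀ U, ∑ e ∈ U, x e ≤ f U)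
    (s : Finset (Finset E)) (hs : ∀ S ∈ s, ∑ e ∈ S, x e = f S) :
    ∑ e ∈ s.sup id, x e = f (s.sup id) :=
  Finset.sup_induction (p := fun S => ∑ e ∈ S, x e = f S) (by simp [hf.normalized])
    (fun _ h _ h' => (hf.tight_union_inter hx h h').1) hs

theorem IsIntegralPolymatroidRank.tight_inf {f : Finset E → ℕ}
    (hf : IsIntegralPolymatroidRank f) {x : E → ℕ} (hx : ∀ U, ∑ e ∈ U, x e ≤ f U)
    (hE : ∑ e, x e = f Finset.univ)
    (s : Finset (Finset E)) (hs : ∀ S ∈ s, ∑ e ∈ S, x e = f S) :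
    ∑ e ∈ s.inf id, x e = f (s.inf id) :=
  Finset.inf_induction (p := fun S => ∑ e ∈ S, x e = f S) hE
    (fun _ h _ h' => (hf.tight_union_inter hx h h').2) hs

omit [DecidableEq E] in
theorem sum_le_truncate {f : Finset E → ℕ} {d : ℕ} {x : E → ℕ} (hx : x ∈ polymatroidBase f d)
    (U : Finset E) : ∑ e ∈ U, x e ≤ min (f U) d :=
  le_min (hx.1 U) (hx.2 ▸ Finset.sum_le_univ_sum_of_nonneg fun _ => Nat.zero_le _)

/-- Only sets containing `b` but not `a` gain load, and by integrality a single unit fits unless the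
set is tight. -/
theorem IsTransfer.mem_polymatroidBase {f : Finset E → ℕ} {d : ℕ} {x y : E → ℕ} {a b : E}
    (h : IsTransfer x y a b) (hx : x ∈ polymatroidBase f d)
    (ht : ∀ U : Finset E, ∑ e ∈ U, x e = min (f U) d → b ∈ U → a ∈ U) :
    y ∈ polymatroidBase f d := by
  refine ⟨fun U => ?_, ?_⟩
  · have h1 := h.sum_eq U
    have h2 := sum_le_truncate hx U
    have h3 := ht U
    by_cases hb : b ∈ U <;> by_cases ha : a ∈ U <;> simp only [hb, ha, if_true, if_false] at h1 h3
      <;> grind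
  · have h1 := h.sum_eq Finset.univ
    simp only [Finset.mem_univ, if_true] at h1
    exact (Nat.add_right_cancel h1).trans hx.2

/-- Symmetric exchange property of the integral bases of a polymatroid. -/
theorem exists_symmetric_exchange {f : Finset E → ℕ} (hf : IsIntegralPolymatroidRank f) {d : ℕ}
    {x z : E → ℕ} (hx : x ∈ polymatroidBase f d) (hz : z ∈ polymatroidBase f d) {e : E}
    (he : z e < x e) :
    ∃ h, x h < z h ∧ (∃ x' ∈ polymatroidBase f d, IsTransfer x x' e h) ∧
      ∃ z' ∈ polymatroidBase f d, IsTransfer z z' h e := by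
  have hg := hf.truncate d
  have hxg := sum_le_truncate hx
  have hzg := sum_le_truncate hz
  have hE : ∑ e, z e = min (f Finset.univ) d := by
    have := hzg Finset.univ
    have := hz.2
    omega
  -- `A.inf id` is the smallest `z`-tight set containing `e`, and `B.sup id` the largest `x`-tight
  -- set avoiding `e`. Any `h` in their difference with `x h < z h` permits both transfers.
  set A : Finset (Finset E) :=
    Finset.univ.filter fun U => ∑ e ∈ U, z e = min (f U) d ∧ e ∈ U with hA
  set B : Finset (Finset E) :=
    Finset.univ.filter fun U => ∑ e ∈ U, x e = min (f U) d ∧ e ∉ U with hB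
  have hT := hg.tight_inf hzg hE A fun S hS => (Finset.mem_filter.mp hS).2.1
  have hS := hg.tight_sup hxg B fun S hS => (Finset.mem_filter.mp hS).2.1
  have heT : e ∈ A.inf id := by
    simp only [Finset.mem_inf, id]
    exact fun S hS => (Finset.mem_filter.mp hS).2.2
  have heS : e ∉ B.sup id := by
    simp only [Finset.mem_sup, id, not_exists, not_and]
    exact fun S hS => (Finset.mem_filter.mp hS).2.2
  set T := A.inf id
  set S := B.sup id
  by_contra! hcon
  have hTS : ∀ h ∈ T \ S, z h ≤ x h := by
    intro h hh
    by_contra! hlt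
    rw [Finset.mem_sdiff] at hh
    obtain ⟨x', hx'⟩ := exists_isTransfer h (Nat.zero_lt_of_lt he)
    obtain ⟨z', hz'⟩ := exists_isTransfer e (Nat.zero_lt_of_lt hlt)
    refine hcon h hlt ⟨x', hx'.mem_polymatroidBase hx fun U hU hhU => ?_, hx'⟩ z'
      (hz'.mem_polymatroidBase hz fun U hU heU => ?_) hz'
    · by_contra heU
      exact hh.2 (Finset.mem_sup.mpr ⟨U, by simp [hB, hU, heU], hhU⟩)
    · exact Finset.mem_inf.mp hh.1 U (by simp [hA, hU, heU])
  -- This makes `x(S ∪ T) + z(S ∩ T)` exceed the sum of the truncated ranks of `S` and `T`, against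
  -- submodularity.
  have h1 : ∑ e ∈ T \ S, z e < ∑ e ∈ T \ S, x e :=
    Finset.sum_lt_sum hTS ⟨e, Finset.mem_sdiff.mpr ⟨heT, heS⟩, he⟩
  have h3 := hg.submodular S T
  have h4 := hxg (S ∪ T)
  have h5 := hzg (S ∩ T)
  have h6 : ∑ e ∈ T \ S, x e + ∑ e ∈ S, x e = ∑ e ∈ S ∪ T, x e := by
    rw [← Finset.sum_union Finset.sdiff_disjoint, Finset.sdiff_union_self_eq_union,
      Finset.union_comm]
  have h7 : ∑ e ∈ S ∩ T, z e + ∑ e ∈ T \ S, z e = ∑ e ∈ T, z e := by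
    rw [Finset.inter_comm, Finset.sum_inter_add_sum_sdiff]
  omega

/-- An independent vector that is not a base of the untruncated polymatroid can be extended. -/
theorem exists_extension {f : Finset E → ℕ} (hf : IsIntegralPolymatroidRank f) {d : ℕ}
    {x : E → ℕ} (hx : x ∈ polymatroidBase f d) (hd : d < f Finset.univ) :
    ∃ r, (fun e => x e + if e = r then 1 else 0) ∈ polymatroidBase f (d + 1) := by
  by_contra! hcon
  have key : ∀ r, ∃ U : Finset E, r ∈ U ∧ ∑ e ∈ U, x e = f U := by
    intro r
    by_contra! hU
    refine hcon r ⟨fun U => ?_, ?_⟩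
    · have h1 := hx.1 U
      have h2 := hU U
      rw [Finset.sum_add_distrib, Finset.sum_ite_eq']
      split_ifs with h
      · have := h2 h
        omega
      · exact h1
    · rw [Finset.sum_add_distrib, hx.2]
      simp
  -- If no unit can be added, tight sets cover the ground set; their union is tight, which forces `d
  -- = f univ`.
  choose U hrU hU using key
  have h := hf.tight_sup hx.1 (Finset.univ.image U) (by simpa using hU)
  have huniv : (Finset.univ.image U).sup id = Finset.univ :=
    Finset.eq_univ_of_forall fun r =>
      Finset.mem_sup.mpr ⟨U r, Finset.mem_image_of_mem _ (Finset.mem_univ r), hrU r⟩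
  rw [huniv, hx.2] at h
  omega

end Polymatroid

/-! ### Optimality and stability of a single player. -/

section SinglePlayer

/-- Marginal costs grow with the own load and with the total load. -/
theorem IsRegularCost.leftDeriv_mono {C : ℕ → ℕ → ℝ} (hC : IsRegularCost C) {u v t t' : ℕ}
    (hu : 1 ≤ u) (huv : u ≤ v) (h : u + t ≤ v + t') : leftDeriv C u t ≤ leftDeriv C v t' := by
  have mono : ∀ {u t t' : ℕ}, 1 ≤ u → t ≤ t' → leftDeriv C u t ≤ leftDeriv C u t' := by
    intro u t t' hu h
    induction t', h using Nat.le_induction with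
    | base => exact le_rfl
    | succ n _ ih => exact ih.trans (hC.mono u n hu)
  induction v, huv using Nat.le_induction generalizing t' with
  | base => exact mono hu (by omega)
  | succ n hn ih => exact (ih (t' := t' + 1) (by omega)).trans (hC.shift n t' (by omega))

variable {E : Type*} [Fintype E] [DecidableEq E] {C : E → ℕ → ℕ → ℝ} {f : Finset E → ℕ} {d : ℕ}
  {x y : E → ℕ} {L t : E → ℕ}

theorem IsTransfer.cost_eq {a b : E} (h : IsTransfer x y a b) (hab : a ≠ b) :
    ∑ e, C e (y e) (t e) = ∑ e, C e (x e) (t e) +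
      leftDeriv (C b) (x b + 1) (t b) - leftDeriv (C a) (x a) (t a) := by
  have h1 := h.sum_apply_add hab fun e u => C e u (t e)
  have h2 := h.source hab
  have h3 := h.target hab
  have h4 : x a - 1 = y a := by omega
  simp only [leftDeriv, h4, Nat.add_sub_cancel]
  rw [h3] at h1
  linarith

/-- Local optimality implies global optimality for regular costs over a polymatroid base. -/
theorem cost_le_of_forall_transfer (hC : ∀ e, IsRegularCost (C e))
    (hf : IsIntegralPolymatroidRank f) (hx : x ∈ polymatroidBase f d)
    (hloc : ∀ a b y, a ≠ b → y ∈ polymatroidBase f d → IsTransfer x y a b →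
      leftDeriv (C a) (x a) (t a) ≤ leftDeriv (C b) (x b + 1) (t b))
    {z : E → ℕ} (hz : z ∈ polymatroidBase f d) :
    ∑ e, C e (x e) (t e) ≤ ∑ e, C e (z e) (t e) := by
  -- An exchange moves `z` towards `x`. Local optimality of `x` and monotone marginal costs show
  -- that it does not raise the cost of `z`.
  induction hn : ∑ e, (x e - z e) using Nat.strong_induction_on generalizing z with
  | _ n ih =>
    by_cases hne : ∃ e, z e < x e
    · obtain ⟨e, he⟩ := hne
      obtain ⟨h, hh, ⟨x', hx', hxx'⟩, z', hz', hzz'⟩ := exists_symmetric_exchange hf hx hz he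
      have hhe : h ≠ e := by rintro rfl; omega
      have h1 := hloc e h x' hhe.symm hx' hxx'
      have h2 := hzz'.cost_eq (C := C) (t := t) hhe
      have h3 : leftDeriv (C h) (x h + 1) (t h) ≤ leftDeriv (C h) (z h) (t h) :=
        (hC h).leftDeriv_mono (by omega) (by omega) (by omega)
      have h4 : leftDeriv (C e) (z e + 1) (t e) ≤ leftDeriv (C e) (x e) (t e) :=
        (hC e).leftDeriv_mono (by omega) (by omega) (by omega)
      have h5 := hzz'.source hhe
      have h6 := hzz'.target hhe
      have hlt : ∑ e, (x e - z' e) < ∑ e, (x e - z e) := by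
        refine Finset.sum_lt_sum (fun i _ => ?_) ⟨e, Finset.mem_univ e, by omega⟩
        rcases eq_or_ne i h with rfl | hih
        · omega
        rcases eq_or_ne i e with rfl | hie
        · omega
        · rw [hzz'.other hih hie]
      have := ih _ (hn ▸ hlt) hz' rfl
      linarith
    · push Not at hne
      have heq := (Finset.sum_eq_sum_iff_of_le fun e _ => hne e).mp (hx.2.trans hz.2.symm)
      exact le_of_eq (Finset.sum_congr rfl fun e he => by rw [heq e he])

theorem forall_transfer_of_cost_le
    (hopt : ∀ z ∈ polymatroidBase f d, ∑ e, C e (x e) (t e) ≤ ∑ e, C e (z e) (t e))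
    {a b : E} (hab : a ≠ b) (hy : y ∈ polymatroidBase f d) (h : IsTransfer x y a b) :
    leftDeriv (C a) (x a) (t a) ≤ leftDeriv (C b) (x b + 1) (t b) := by
  have h1 := hopt y hy
  have h2 := h.cost_eq (C := C) (t := t) hab
  linarith

/-- No transfer of a unit is profitable when the total loads are `L`; the own load `x` may exceed
`L`. -/
def IsStable (C : E → ℕ → ℕ → ℝ) (L : E → ℕ) (B : Set (E → ℕ)) (x : E → ℕ) : Prop :=
  ∀ a b y, a ≠ b → y ∈ B → IsTransfer x y a b →
    leftDeriv (C a) (x a) (L a - x a) ≤ leftDeriv (C b) (x b + 1) (L b - x b)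

/-! ### Reactions to one surplus unit on `r`. -/

section Move

variable {r : E} (hC : ∀ e, IsRegularCost (C e)) (hf : IsIntegralPolymatroidRank f)
  (hx : x ∈ polymatroidBase f d) (ht : ∀ e, t e + x e = L e + if e = r then 1 else 0)
  (hs : IsStable C L (polymatroidBase f d) x)

include hC ht hs

/-- Off `r` the source carries exactly its load in `L`, while the target carries at least its own;
so profitable transfers must start at `r`. -/
theorem IsStable.le_of_ne {a b : E} (hab : a ≠ b) (har : a ≠ r)
    (hy : y ∈ polymatroidBase f d) (h : IsTransfer x y a b) :
    leftDeriv (C a) (x a) (t a) ≤ leftDeriv (C b) (x b + 1) (t b) := by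
  have h1 := ht a
  have h2 := ht b
  have h3 := h.source_pos hab
  simp only [har, if_false] at h1
  refine ((hC a).leftDeriv_mono h3 le_rfl ?_).trans ((hs a b y hab hy h).trans
    ((hC b).leftDeriv_mono (by omega) le_rfl ?_))
  · omega
  · split_ifs at h2 <;> omega

/-- Once one unit has left `r`, its total load is back to `L r`, so a second unit has no reason to
leave. -/
theorem IsStable.pred_le {b : E} (hrb : r ≠ b) (hxr : 2 ≤ x r)
    (hy : y ∈ polymatroidBase f d) (h : IsTransfer x y r b) :
    leftDeriv (C r) (x r - 1) (t r) ≤ leftDeriv (C b) (x b + 1) (t b) := by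
  have h1 := ht r
  have h2 := ht b
  simp only [if_true, hrb.symm, if_false] at h1 h2
  exact ((hC r).leftDeriv_mono (by omega) (by omega) (by omega)).trans ((hs r b y hrb hy h).trans
    ((hC b).leftDeriv_mono (by omega) le_rfl (by omega)))

include hf hx

/-- Some optimal strategy of a player that can improve is at distance two; it relieves the
overloaded resource `r`. -/
theorem IsStable.exists_optimal_transfer
    (himp : ∃ z ∈ polymatroidBase f d, ∑ e, C e (z e) (t e) < ∑ e, C e (x e) (t e)) :
    ∃ g, r ≠ g ∧ ∃ y ∈ polymatroidBase f d, IsTransfer x y r g ∧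
      ∀ z ∈ polymatroidBase f d, ∑ e, C e (y e) (t e) ≤ ∑ e, C e (z e) (t e) := by
  classical
  have h0 : ∃ b y, r ≠ b ∧ y ∈ polymatroidBase f d ∧ IsTransfer x y r b ∧
      leftDeriv (C b) (x b + 1) (t b) < leftDeriv (C r) (x r) (t r) := by
    by_contra! hcon
    obtain ⟨z, hz, hlt⟩ := himp
    refine hlt.not_ge (cost_le_of_forall_transfer hC hf hx (fun a b y hab hy h => ?_) hz)
    by_cases har : a = r
    · subst har
      exact hcon b y hab hy h
    · exact hs.le_of_ne hC ht hab har hy h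
  obtain ⟨b, w, hrb, hw, hxw, hlt⟩ := h0
  -- The cheapest feasible target `g` is the candidate; the rest checks that no further transfer `e
  -- → h` improves on it.
  obtain ⟨g, hg, hmin⟩ := Finset.exists_min_image
    (Finset.univ.filter fun g => r ≠ g ∧ ∃ y ∈ polymatroidBase f d, IsTransfer x y r g)
    (fun g => leftDeriv (C g) (x g + 1) (t g))
    ⟨b, Finset.mem_filter.mpr ⟨Finset.mem_univ _, hrb, w, hw, hxw⟩⟩
  simp only [Finset.mem_filter, Finset.mem_univ, true_and] at hg hmin
  obtain ⟨hrg, y, hy, hxy⟩ := hg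
  replace hmin : ∀ h, r ≠ h → ∀ y ∈ polymatroidBase f d, IsTransfer x y r h →
      leftDeriv (C g) (x g + 1) (t g) ≤ leftDeriv (C h) (x h + 1) (t h) :=
    fun h hh y hy hxy => hmin h ⟨hh, y, hy, hxy⟩
  replace hlt : leftDeriv (C g) (x g + 1) (t g) < leftDeriv (C r) (x r) (t r) :=
    (hmin b hrb w hw hxw).trans_lt hlt
  refine ⟨g, hrg, y, hy, hxy, fun z hz =>
    cost_le_of_forall_transfer hC hf hy (fun e h z hne hz hyz => ?_) hz⟩
  have hyr := hxy.source hrg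
  have hyg := hxy.target hrg
  have hze := hyz.source hne
  have hzh := hyz.target hne
  have hcomp : ∀ i, z i + (if i = r then 1 else 0) + (if i = e then 1 else 0) =
      x i + (if i = g then 1 else 0) + (if i = h then 1 else 0) := by
    intro i
    have h1 := hxy i
    have h2 := hyz i
    omega
  have hgstep : leftDeriv (C g) (x g + 1) (t g) ≤ leftDeriv (C g) (x g + 1 + 1) (t g) :=
    (hC g).leftDeriv_mono (by omega) (by omega) (by omega)
  by_cases heg : e = g
  · subst heg
    rw [hyg]
    by_cases hhr : h = r
    · subst hhr
      rw [hyr]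
      exact hlt.le
    · rw [hxy.other hhr hne.symm]
      exact hmin h (Ne.symm hhr) z hz fun i => by
        have := hcomp i
        omega
  by_cases her : e = r
  · subst her
    have hye : y e = x e - 1 := by omega
    rw [hye]
    by_cases hhg : h = g
    · subst hhg
      rw [hyg]
      exact (hs.pred_le hC ht hrg (by omega) hy hxy).trans hgstep
    · rw [hxy.other hne.symm hhg]
      have hxh : x h < z h := by
        have := hcomp h
        simp only [hne.symm, hhg, if_true, if_false] at this
        omega
      -- Two units leave `r`, which is thus the only possible partner of `h`; hence `r → h` is
      -- already feasible from `x`.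
      obtain ⟨i, hi, -, x', hx', hxx'⟩ := exists_symmetric_exchange hf hz hx hxh
      have hie : i = e := by
        by_contra hie
        have := hcomp i
        simp only [hie, if_false] at this
        omega
      subst hie
      exact hs.pred_le hC ht hne (by omega) hx' hxx'
  rw [hxy.other her heg]
  by_cases hhr : h = r
  · subst hhr
    rw [hyr]
    refine (hs.le_of_ne hC ht heg her hz fun i => ?_).trans hlt.le
    have := hcomp i
    omega
  by_cases hhg : h = g
  · subst hhg
    rw [hyg]
    refine le_trans ?_ hgstep
    have hze : z e < x e := by
      have := hcomp e
      simp only [her, hne, if_true, if_false] at this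
      omega
    obtain ⟨i, hi, ⟨x', hx', hxx'⟩, -⟩ := exists_symmetric_exchange hf hx hz hze
    have hig : i = h := by
      by_contra hig
      have := hcomp i
      simp only [hig, if_false] at this
      omega
    subst hig
    exact hs.le_of_ne hC ht heg her hx' hxx'
  · rw [hxy.other hhr hhg]
    have hze : z e < x e := by
      have := hcomp e
      simp only [her, hne, heg, if_true, if_false] at this
      omega
    by_cases hfeas : ∃ x' ∈ polymatroidBase f d, IsTransfer x x' e h
    · obtain ⟨x', hx', hxx'⟩ := hfeas
      exact hs.le_of_ne hC ht hne her hx' hxx'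
    -- If `e → h` is infeasible from `x`, exchange forces both `e → g` and `r → h` to be feasible;
    -- stability compares `e` with `g`, and the choice of `g` compares `g` with `h`.
    obtain ⟨i, hi, ⟨x', hx', hxx'⟩, -⟩ := exists_symmetric_exchange hf hx hz hze
    have hig : i = g := by
      by_contra hig
      by_cases hih : i = h
      · subst hih
        exact hfeas ⟨x', hx', hxx'⟩
      have := hcomp i
      simp only [hig, hih, if_false] at this
      omega
    subst hig
    have hxh : x h < z h := by
      have := hcomp h
      simp only [hne.symm, hhg, hhr, if_true, if_false] at this
      omega
    obtain ⟨j, hj, -, v, hv, hxv⟩ := exists_symmetric_exchange hf hz hx hxh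
    have hjr : j = r := by
      by_contra hjr
      by_cases hje : j = e
      · subst hje
        exact hfeas ⟨v, hv, hxv⟩
      have := hcomp j
      simp only [hjr, hje, if_false] at this
      omega
    subst hjr
    exact (hs.le_of_ne hC ht heg her hx' hxx').trans (hmin h (Ne.symm hhr) v hv hxv)

/-- An optimal transfer that improves takes a unit from the overloaded resource `r` and keeps the
player stable with respect to the loads `L`. -/
theorem IsStable.of_optimal_transfer {a b : E} (hab : a ≠ b) (hy : y ∈ polymatroidBase f d)
    (hxy : IsTransfer x y a b)
    (hopt : ∀ z ∈ polymatroidBase f d, ∑ e, C e (y e) (t e) ≤ ∑ e, C e (z e) (t e))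
    (hlt : ∑ e, C e (y e) (t e) < ∑ e, C e (x e) (t e)) :
    a = r ∧ leftDeriv (C b) (x b + 1) (L b - x b) <
        leftDeriv (C a) (x a) (L a + 1 - x a) ∧
      IsStable C L (polymatroidBase f d) y := by
  have hcost := hxy.cost_eq (C := C) (t := t) hab
  have hlt' : leftDeriv (C b) (x b + 1) (t b) < leftDeriv (C a) (x a) (t a) := by linarith
  have har : a = r := by
    by_contra har
    exact hlt'.not_ge (hs.le_of_ne hC ht hab har hy hxy)
  subst har
  have hta := ht a
  have htb := ht b
  simp only [if_true, hab.symm, if_false] at hta htb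
  have hta' : L a + 1 - x a = t a := by omega
  have htb' : L b - x b = t b := by omega
  refine ⟨rfl, by rwa [hta', htb'], fun e h z hne hz hyz => ?_⟩
  have hya := hxy.source hab
  have hyb := hxy.target hab
  have hze := hyz.source hne
  -- On `b` the actual load now exceeds `L` by one, so optimality of `y` is too weak and the
  -- stability of `x` is used; every other target carries exactly its load in `L`, where optimality
  -- suffices.
  by_cases hhb : h = b
  · subst hhb
    rw [hyb]
    have hcomp : ∀ i, z i + (if i = a then 1 else 0) + (if i = e then 1 else 0) =
        x i + (if i = h then 1 else 0) + (if i = h then 1 else 0) := by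
      intro i
      have h1 := hxy i
      have h2 := hyz i
      omega
    have hstep : leftDeriv (C h) (x h + 1) (L h - x h) ≤
        leftDeriv (C h) (x h + 1 + 1) (L h - (x h + 1)) :=
      (hC h).leftDeriv_mono (by omega) (by omega) (by omega)
    refine le_trans ?_ hstep
    by_cases hea : e = a
    · subst hea
      exact ((hC e).leftDeriv_mono (by omega) (by omega) (by omega)).trans
        (hs e h y hab hy hxy)
    · rw [hxy.other hea hne]
      have hze : z e < x e := by
        have := hcomp e
        simp only [hea, hne, if_true, if_false] at this
        omega
      obtain ⟨i, hi, ⟨x', hx', hxx'⟩, -⟩ := exists_symmetric_exchange hf hx hz hze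
      have hih : i = h := by
        by_contra hih
        have := hcomp i
        simp only [hih, if_false] at this
        omega
      subst hih
      exact hs e i x' hne hx' hxx'
  · have h1 := forall_transfer_of_cost_le hopt hne hz hyz
    have hte := ht e
    have hth := ht h
    refine ((hC e).leftDeriv_mono (by omega) le_rfl ?_).trans (h1.trans
      ((hC h).leftDeriv_mono (by omega) le_rfl ?_))
    · have := hxy e
      split_ifs at * <;> omega
    · have := hxy h
      simp only [hhb, if_false] at this
      split_ifs at * <;> omega

end Move

/-- An optimal strategy is stable with respect to the actual loads. -/
theorem isStable_of_optimal (ht : ∀ e, t e + x e = L e)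
    (hopt : ∀ z ∈ polymatroidBase f d, ∑ e, C e (x e) (t e) ≤ ∑ e, C e (z e) (t e)) :
    IsStable C L (polymatroidBase f d) x := by
  intro a b y hab hy h
  have h1 := forall_transfer_of_cost_le hopt hab hy h
  have h2 : L a - x a = t a := by
    have := ht a
    omega
  have h3 : L b - x b = t b := by
    have := ht b
    omega
  rwa [h2, h3]

omit [DecidableEq E] in
theorem mem_polymatroidBase_of_le {x y : E → ℕ} (h : ∀ e, x e ≤ y e) {k : ℕ}
    (hy : y ∈ polymatroidBase f k) (hsum : ∑ e, x e = d) : x ∈ polymatroidBase f d :=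
  ⟨fun U => (Finset.sum_le_sum fun e _ => h e).trans (hy.1 U), hsum⟩

/-- If the demand grows by one, an optimal strategy can be turned into an optimal strategy by
adding one unit. -/
theorem exists_optimal_extension (hC : ∀ e, IsRegularCost (C e))
    (hf : IsIntegralPolymatroidRank f) (hx : x ∈ polymatroidBase f d)
    (hd : d < f Finset.univ)
    (hopt : ∀ z ∈ polymatroidBase f d, ∑ e, C e (x e) (t e) ≤ ∑ e, C e (z e) (t e)) :
    ∃ r, ∃ y ∈ polymatroidBase f (d + 1), (∀ e, y e = x e + if e = r then 1 else 0) ∧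
      ∀ z ∈ polymatroidBase f (d + 1), ∑ e, C e (y e) (t e) ≤ ∑ e, C e (z e) (t e) := by
  classical
  obtain ⟨b, hb⟩ := exists_extension hf hx hd
  obtain ⟨r, hr, hmin⟩ := Finset.exists_min_image
    (Finset.univ.filter fun r =>
      (fun e => x e + if e = r then 1 else 0) ∈ polymatroidBase f (d + 1))
    (fun r => leftDeriv (C r) (x r + 1) (t r))
    ⟨b, Finset.mem_filter.mpr ⟨Finset.mem_univ _, hb⟩⟩
  simp only [Finset.mem_filter, Finset.mem_univ, true_and] at hr hmin
  refine ⟨r, _, hr, fun _ => rfl, fun z hz =>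
    cost_le_of_forall_transfer hC hf hr (fun e h z hne hz hyz => ?_) hz⟩
  by_cases her : e = r
  · subst her
    simp only [if_true, hne.symm, if_false, add_zero]
    refine hmin h (Set.mem_of_eq_of_mem (funext fun i => ?_) hz)
    have := hyz i
    simp only at this
    omega
  · have hze := hyz.source hne
    simp only [her, if_false, add_zero] at hze ⊢
    obtain ⟨w, hxw⟩ := exists_isTransfer (x := x) (a := e) h (by omega)
    have hw : w ∈ polymatroidBase f d := by
      refine mem_polymatroidBase_of_le (fun i => ?_) hz ?_
      · have h1 := hyz i
        have h2 := hxw i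
        simp only at h1
        omega
      · have := hxw.sum_eq Finset.univ
        simp only [Finset.mem_univ, if_true] at this
        have := hx.2
        omega
    exact (forall_transfer_of_cost_le hopt hne hw hxw).trans
      ((hC h).leftDeriv_mono (by omega) (by omega) (by omega))

/-- Stability with respect to the old loads is kept when the demand grows by one. -/
theorem IsStable.of_optimal_extension (hC : ∀ e, IsRegularCost (C e)) {r : E}
    (hx : x ∈ polymatroidBase f d) (ht : ∀ e, t e + x e = L e)
    (hs : IsStable C L (polymatroidBase f d) x)
    (hxy : ∀ e, y e = x e + if e = r then 1 else 0)
    (hopt : ∀ z ∈ polymatroidBase f (d + 1), ∑ e, C e (y e) (t e) ≤ ∑ e, C e (z e) (t e)) :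
    IsStable C L (polymatroidBase f (d + 1)) y := by
  intro e h z hne hz hyz
  have hye := hxy e
  have hyh := hxy h
  have hte := ht e
  have hth := ht h
  have hze := hyz.source hne
  -- For the newly loaded `r` optimality is too weak, and the old stability of `x` takes over.
  by_cases hhr : h = r
  · subst hhr
    simp only [hne, if_true, if_false, add_zero] at hye hyh
    rw [hye] at hze ⊢
    obtain ⟨w, hxw⟩ := exists_isTransfer (x := x) (a := e) h (by omega)
    have hw : w ∈ polymatroidBase f d := by
      refine mem_polymatroidBase_of_le (fun i => ?_) hz ?_
      · have h1 := hyz i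
        have h2 := hxw i
        have h3 := hxy i
        omega
      · have := hxw.sum_eq Finset.univ
        simp only [Finset.mem_univ, if_true] at this
        have := hx.2
        omega
    exact (hs e h w hne hw hxw).trans
      ((hC h).leftDeriv_mono (by omega) (by omega) (by omega))
  · have h1 := forall_transfer_of_cost_le hopt hne hz hyz
    simp only [hhr, if_false, add_zero] at hyh
    refine ((hC e).leftDeriv_mono (by omega) le_rfl ?_).trans (h1.trans
      ((hC h).leftDeriv_mono (by omega) le_rfl ?_)) <;> omega

end SinglePlayer

/-! ### Steps of distance one and two as additions and transfers of a unit. -/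

section L1Distance

variable {E : Type*} [Fintype E] [DecidableEq E]

theorem eq_ite_of_sum_eq_one {g : E → ℕ} (h : ∑ e, g e = 1) :
    ∃ a, ∀ e, g e = if e = a then 1 else 0 := by
  have hpos : ∃ a, 0 < g a := by
    by_contra! hcon
    rw [Finset.sum_eq_zero fun e _ => Nat.le_zero.mp (hcon e)] at h
    omega
  obtain ⟨a, ha⟩ := hpos
  refine ⟨a, fun e => ?_⟩
  have h1 := Finset.add_sum_erase Finset.univ g (Finset.mem_univ a)
  split_ifs with he
  · subst he
    omega
  · have h2 := Finset.single_le_sum (f := g) (fun _ _ => Nat.zero_le _)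
      (Finset.mem_erase.mpr ⟨he, Finset.mem_univ e⟩)
    omega

omit [DecidableEq E] in
theorem l1Dist_eq_sum (x y : E → ℕ) :
    l1Dist y x = ((∑ e, (y e - x e) + ∑ e, (x e - y e) : ℕ) : ℤ) := by
  rw [l1Dist, ← Finset.sum_add_distrib, Nat.cast_sum]
  refine Finset.sum_congr rfl fun e _ => ?_
  rcases abs_cases ((y e : ℤ) - x e) with h | h <;> omega

omit [DecidableEq E] in
theorem sum_add_sum_tsub (x y : E → ℕ) :
    ∑ e, y e + ∑ e, (x e - y e) = ∑ e, x e + ∑ e, (y e - x e) := by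
  rw [← Finset.sum_add_distrib, ← Finset.sum_add_distrib]
  exact Finset.sum_congr rfl fun e _ => by omega

theorem exists_extension_of_l1Dist_eq_one {x y : E → ℕ} (h : l1Dist y x = 1)
    (hsum : ∑ e, y e = ∑ e, x e + 1) : ∃ r, ∀ e, y e = x e + if e = r then 1 else 0 := by
  rw [l1Dist_eq_sum] at h
  have h1 := sum_add_sum_tsub x y
  have h2 : ∑ e, (x e - y e) = 0 := by omega
  obtain ⟨r, hr⟩ := eq_ite_of_sum_eq_one (g := fun e => y e - x e) (by omega)
  refine ⟨r, fun e => ?_⟩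
  have h3 := Finset.sum_eq_zero_iff.mp h2 e (Finset.mem_univ e)
  have h4 := hr e
  omega

theorem exists_isTransfer_of_l1Dist_eq_two {x y : E → ℕ} (h : l1Dist y x = 2)
    (hsum : ∑ e, y e = ∑ e, x e) : ∃ a b, a ≠ b ∧ IsTransfer x y a b := by
  rw [l1Dist_eq_sum] at h
  have h1 := sum_add_sum_tsub x y
  obtain ⟨a, ha⟩ := eq_ite_of_sum_eq_one (g := fun e => x e - y e) (by omega)
  obtain ⟨b, hb⟩ := eq_ite_of_sum_eq_one (g := fun e => y e - x e) (by omega)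
  refine ⟨a, b, ?_, fun e => ?_⟩
  · rintro rfl
    have h3 := ha a
    have h4 := hb a
    simp only [if_true] at h3 h4
    omega
  · have h3 := ha e
    have h4 := hb e
    omega

theorem l1Dist_eq_one_of_extension {x y : E → ℕ} {r : E}
    (h : ∀ e, y e = x e + if e = r then 1 else 0) : l1Dist y x = 1 := by
  simp [l1Dist, h, apply_ite abs]

theorem IsTransfer.l1Dist_eq_two {x y : E → ℕ} {a b : E} (h : IsTransfer x y a b) (hab : a ≠ b) :
    l1Dist y x = 2 := by
  have key : ∀ e, y e - x e + (x e - y e) =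
      (if e = a then 1 else 0) + if e = b then 1 else 0 := by
    intro e
    have := h e
    have : ¬ (e = a ∧ e = b) := fun h => hab (h.1.symm.trans h.2)
    split_ifs at * <;> first | omega | tauto
  rw [l1Dist_eq_sum, ← Finset.sum_add_distrib, Finset.sum_congr rfl fun e _ => key e]
  simp [Finset.sum_add_distrib]

end L1Distance

namespace PolymatroidGame

variable {N E : Type*} [Fintype N] [DecidableEq N] [Fintype E] [DecidableEq E]
  (G : PolymatroidGame N E)

omit [Fintype E] [DecidableEq E] in
theorem othersLoad_add (x : N → E → ℕ) (i : N) (e : E) :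
    othersLoad x i e + x i e = ∑ j, x j e :=
  Finset.sum_erase_add _ _ (Finset.mem_univ i)

omit [Fintype E] [DecidableEq E] in
theorem othersLoad_update (x : N → E → ℕ) (i : N) (y : E → ℕ) :
    othersLoad (Function.update x i y) i = othersLoad x i := by
  funext e
  refine Finset.sum_congr rfl fun j hj => ?_
  rw [Function.update_of_ne (Finset.ne_of_mem_erase hj)]

theorem privateCost_update (i : N) (x : N → E → ℕ) (y : E → ℕ) :
    G.privateCost i (Function.update x i y) = ∑ e, G.C i e (y e) (othersLoad x i e) := by
  simp [privateCost, othersLoad_update]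

theorem isBestResponse_iff {i : N} {k : ℕ} {x : N → E → ℕ} {y : E → ℕ} :
    G.IsBestResponse i k x y ↔ y ∈ polymatroidBase (G.f i) k ∧
      ∀ z ∈ polymatroidBase (G.f i) k, ∑ e, G.C i e (y e) (othersLoad x i e) ≤
        ∑ e, G.C i e (z e) (othersLoad x i e) := by
  simp [IsBestResponse, privateCost_update]

theorem not_canImprove_iff {s : State N E} {i : N} :
    ¬ G.CanImprove s i ↔ ∀ z ∈ polymatroidBase (G.f i) (s.dbar i),
      ∑ e, G.C i e (s.x i e) (othersLoad s.x i e) ≤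
        ∑ e, G.C i e (z e) (othersLoad s.x i e) := by
  simp only [CanImprove, privateCost_update, not_exists, not_and, not_lt]
  rfl

/-! ### The rank potential within a phase. -/

section Potential

variable (L : E → ℕ)

/-- The cost of the `(u + 1)`-st unit of player `i` on `e` when the total load is `L e + 1`. -/
def unitCost (i : N) (e : E) (u : ℕ) : ℝ := leftDeriv (G.C i e) (u + 1) (L e - u)

/-- The possible costs of a single unit of player `i`. -/
noncomputable def unitCosts (i : N) : Finset ℝ :=
  (Finset.univ ×ˢ Finset.range (Finset.univ.sup G.d)).image fun p => G.unitCost L i p.1 p.2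

/-- The rank of the cost of a unit among all possible costs of a unit of player `i`. -/
noncomputable def unitRank (i : N) (e : E) (u : ℕ) : ℕ :=
  ((G.unitCosts L i).filter (· < G.unitCost L i e u)).card

/-- The sum of the ranks of all units. -/
noncomputable def potential (x : N → E → ℕ) : ℕ := ∑ i, ∑ e, ∑ u ∈ Finset.range (x i e), G.unitRank L i e u

variable {L}

omit [DecidableEq N] in
theorem unitCost_mem {i : N} {e : E} {u : ℕ} (hu : u < Finset.univ.sup G.d) :
    G.unitCost L i e u ∈ G.unitCosts L i :=
  Finset.mem_image.mpr ⟨(e, u), by simpa using hu, rfl⟩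

omit [DecidableEq N] in
theorem unitRank_lt {i : N} {e : E} {u : ℕ} (hu : u < Finset.univ.sup G.d) :
    G.unitRank L i e u < Fintype.card E * Finset.univ.sup G.d := by
  have h1 : (G.unitCosts L i).card ≤ Fintype.card E * Finset.univ.sup G.d := by
    refine Finset.card_image_le.trans ?_
    simp
  refine lt_of_lt_of_le (Finset.card_lt_card ?_) h1
  exact Finset.filter_ssubset.mpr ⟨_, G.unitCost_mem hu, lt_irrefl _⟩

omit [DecidableEq N] in
theorem unitRank_lt_unitRank {i : N} {a b : E} {u v : ℕ} (hu : u < Finset.univ.sup G.d)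
    (h : G.unitCost L i a u < G.unitCost L i b v) : G.unitRank L i a u < G.unitRank L i b v := by
  refine Finset.card_lt_card (Finset.ssubset_iff_of_subset ?_ |>.mpr ?_)
  · exact Finset.monotone_filter_right _ fun c _ hc => lt_trans hc h
  · exact ⟨_, Finset.mem_filter.mpr ⟨G.unitCost_mem hu, h⟩, by simp⟩

omit [DecidableEq N] in
theorem potential_le {x : N → E → ℕ} (hx : ∀ i, ∑ e, x i e ≤ G.d i) :
    G.potential L x ≤ Fintype.card N * Finset.univ.sup G.d *
      (Fintype.card E * Finset.univ.sup G.d - 1) := by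
  have hd : ∀ i, G.d i ≤ Finset.univ.sup G.d := fun i => Finset.le_sup (Finset.mem_univ i)
  have key : ∀ i, ∑ e, ∑ u ∈ Finset.range (x i e), G.unitRank L i e u ≤
      Finset.univ.sup G.d * (Fintype.card E * Finset.univ.sup G.d - 1) := by
    intro i
    calc ∑ e, ∑ u ∈ Finset.range (x i e), G.unitRank L i e u
        ≤ ∑ e, x i e * (Fintype.card E * Finset.univ.sup G.d - 1) := by
          refine Finset.sum_le_sum fun e _ => ?_
          refine (Finset.sum_le_card_nsmul _ _
            (Fintype.card E * Finset.univ.sup G.d - 1) fun u hu => ?_).trans (by simp)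
          have h1 : x i e ≤ ∑ e, x i e :=
            Finset.single_le_sum (fun _ _ => Nat.zero_le _) (Finset.mem_univ e)
          have h2 := Finset.mem_range.mp hu
          have h3 := hx i
          have h4 := hd i
          have := G.unitRank_lt (L := L) (i := i) (e := e) (u := u) (by omega)
          omega
      _ = (∑ e, x i e) * (Fintype.card E * Finset.univ.sup G.d - 1) :=
          (Finset.sum_mul _ _ _).symm
      _ ≤ _ := Nat.mul_le_mul_right _ ((hx i).trans (hd i))
  calc G.potential L x ≤ ∑ _i : N, Finset.univ.sup G.d *
        (Fintype.card E * Finset.univ.sup G.d - 1) := Finset.sum_le_sum fun i _ => key i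
    _ = _ := by simp [mul_assoc]

/-- With `L` fixed, only two units matter: the top one on `a`, of index `y a`, disappears, and one
of index `x i b` appears on `b`. -/
theorem potential_update_lt {x : N → E → ℕ} {i : N} {y : E → ℕ} {a b : E}
    (hxy : IsTransfer (x i) y a b) (hab : a ≠ b) (hx : ∑ e, x i e ≤ G.d i)
    (hlt : G.unitCost L i b (x i b) < G.unitCost L i a (y a)) :
    G.potential L (Function.update x i y) < G.potential L x := by
  have h1 := hxy.source hab
  have h2 := hxy.target hab
  have h3 := hxy.sum_apply_add hab fun e k => ∑ u ∈ Finset.range k, G.unitRank L i e u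
  have hb : x i b < Finset.univ.sup G.d := by
    have h4 : y b ≤ ∑ e, y e :=
      Finset.single_le_sum (fun _ _ => Nat.zero_le _) (Finset.mem_univ b)
    have h5 := hxy.sum_eq Finset.univ
    simp only [Finset.mem_univ, if_true] at h5
    have h6 : G.d i ≤ Finset.univ.sup G.d := Finset.le_sup (Finset.mem_univ i)
    omega
  have hrank := G.unitRank_lt_unitRank hb hlt
  rw [← h1, h2, Finset.sum_range_succ, Finset.sum_range_succ] at h3
  have key : ∑ e, ∑ u ∈ Finset.range (y e), G.unitRank L i e u <
      ∑ e, ∑ u ∈ Finset.range (x i e), G.unitRank L i e u := by omega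
  refine Finset.sum_lt_sum (fun j _ => ?_) ⟨i, Finset.mem_univ i, ?_⟩
  · rcases eq_or_ne j i with rfl | hj
    · rw [Function.update_self]
      exact key.le
    · rw [Function.update_of_ne hj]
  · rwa [Function.update_self]

end Potential

/-- The invariant of the algorithm: in a phase, the loads exceed the loads `L` of the preceding
equilibrium by one unit on a single resource, every player is stable with respect to `L`, and the
number of improvements is controlled by the potential. -/
def Invariant (k l : ℕ) (s : State N E) : Prop :=
  (∀ i, s.dbar i ≤ G.d i) ∧ ∑ i, s.dbar i = k ∧
  (∀ i, s.x i ∈ polymatroidBase (G.f i) (s.dbar i)) ∧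
  (k = 0 ∧ l = 0 ∨ ∃ (L : E → ℕ) (r : E),
    (∀ e, ∑ j, s.x j e = L e + if e = r then 1 else 0) ∧
    (∀ i, IsStable (G.C i) L (polymatroidBase (G.f i) (s.dbar i)) (s.x i)) ∧
    l + G.potential L s.x ≤ k * (Fintype.card N * Finset.univ.sup G.d *
      (Fintype.card E * Finset.univ.sup G.d - 1)))

/-! ### Preservation of the invariant and its consequences. -/

variable {G} {k l : ℕ} {s s' : State N E}

omit [DecidableEq N] in
theorem Invariant.sum_le (h : G.Invariant k l s) (i : N) : ∑ e, s.x i e ≤ G.d i :=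
  (h.2.2.1 i).2.trans_le (h.1 i)

/-- Before the first phase there is no surplus resource, as `E` may even be empty; all demands are
zero, so each player has only the zero strategy. -/
theorem Invariant.not_canImprove_zero (h : G.Invariant 0 l s) (i : N) : ¬ G.CanImprove s i := by
  obtain ⟨-, hsum, hmem, -⟩ := h
  have hd : s.dbar i = 0 := Finset.sum_eq_zero_iff.mp hsum i (Finset.mem_univ i)
  have hzero : ∀ z ∈ polymatroidBase (G.f i) (s.dbar i), ∀ e, z e = 0 := fun z hz e =>
    Finset.sum_eq_zero_iff.mp (hz.2.trans hd) e (Finset.mem_univ e)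
  rw [not_canImprove_iff]
  intro z hz
  refine le_of_eq (Finset.sum_congr rfl fun e _ => ?_)
  rw [hzero z hz e, hzero _ (hmem i) e]

theorem Invariant.phase (h : G.Invariant k l s) {i : N} (hi : G.CanImprove s i) :
    ∃ (L : E → ℕ) (r : E),
      (∀ j e, othersLoad s.x j e + s.x j e = L e + if e = r then 1 else 0) ∧
      (∀ j, IsStable (G.C j) L (polymatroidBase (G.f j) (s.dbar j)) (s.x j)) ∧
      l + G.potential L s.x ≤ k * (Fintype.card N * Finset.univ.sup G.d *
        (Fintype.card E * Finset.univ.sup G.d - 1)) := by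
  rcases h.2.2.2 with ⟨rfl, -⟩ | ⟨L, r, hL, hs, hpot⟩
  · exact absurd hi (h.not_canImprove_zero i)
  · exact ⟨L, r, fun j e => (othersLoad_add s.x j e).trans (hL e), hs, hpot⟩

theorem Invariant.exists_improveStep (h : G.Invariant k l s) {i : N} (hi : G.CanImprove s i) :
    ∃ s', G.ImproveStep i s s' := by
  obtain ⟨L, r, hL, hs, -⟩ := h.phase hi
  have himp := hi
  simp only [CanImprove, privateCost_update] at himp
  obtain ⟨g, hrg, y, hy, hxy, hopt⟩ := (hs i).exists_optimal_transfer (G.regular_C i) (G.rank_f i)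
    (h.2.2.1 i) (hL i) himp
  exact ⟨_, hi, y, (G.isBestResponse_iff).mpr ⟨hy, hopt⟩, hxy.l1Dist_eq_two hrg, rfl⟩

theorem Invariant.exists_increaseStep (h : G.Invariant k l s) {i : N}
    (hno : ¬ G.CanImprove s i) (hi : s.dbar i < G.d i) : ∃ s', G.IncreaseStep i s s' := by
  obtain ⟨r, y, hy, hxy, hopt⟩ := exists_optimal_extension (G.regular_C i) (G.rank_f i)
    (h.2.2.1 i) (hi.trans_le (G.d_le i)) (G.not_canImprove_iff.mp hno)
  exact ⟨_, hi, y, (G.isBestResponse_iff).mpr ⟨hy, hopt⟩, l1Dist_eq_one_of_extension hxy, rfl⟩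

theorem Invariant.improve (h : G.Invariant k l s) {i : N} (hstep : G.ImproveStep i s s') :
    G.Invariant k (l + 1) s' := by
  obtain ⟨hi, y, hbest, hdist, rfl⟩ := hstep
  obtain ⟨L, r, hL, hs, hpot⟩ := h.phase hi
  rw [isBestResponse_iff] at hbest
  obtain ⟨hy, hopt⟩ := hbest
  have hx := h.2.2.1 i
  obtain ⟨a, b, hab, hxy⟩ := exists_isTransfer_of_l1Dist_eq_two hdist (hy.2.trans hx.2.symm)
  have hlt : ∑ e, G.C i e (y e) (othersLoad s.x i e) <
      ∑ e, G.C i e (s.x i e) (othersLoad s.x i e) := by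
    obtain ⟨z, hz, hzlt⟩ := hi
    rw [privateCost_update] at hzlt
    exact (hopt z hz).trans_lt hzlt
  obtain ⟨rfl, hcost, hstab⟩ :=
    (hs i).of_optimal_transfer (G.regular_C i) (G.rank_f i) hx (hL i) hab hy hxy hopt hlt
  -- The surplus moves from `a` to `b` while `L` stays the same.
  refine ⟨h.1, h.2.1, fun j => ?_, Or.inr ⟨L, b, fun e => ?_, fun j => ?_, ?_⟩⟩
  · rcases eq_or_ne j i with rfl | hj
    · simpa using hy
    · simpa [Function.update_of_ne hj] using h.2.2.1 j
  · have h1 := othersLoad_add (Function.update s.x i y) i e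
    rw [othersLoad_update, Function.update_self] at h1
    have h2 := hL i e
    have h3 := hxy e
    simp only
    omega
  · rcases eq_or_ne j i with rfl | hj
    · simpa using hstab
    · simpa [Function.update_of_ne hj] using hs j
  · have hya := hxy.source hab
    have h1 : L a + 1 - s.x i a = L a - y a := by omega
    have := G.potential_update_lt (L := L) hxy hab (h.sum_le i) (by
      rw [unitCost, unitCost, hya, ← h1]
      exact hcost)
    simp only
    omega

theorem Invariant.increase (h : G.Invariant k l s) (hno : ∀ j, ¬ G.CanImprove s j) {i : N}
    (hstep : G.IncreaseStep i s s') : G.Invariant (k + 1) l s' := by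
  obtain ⟨hi, y, hbest, hdist, rfl⟩ := hstep
  rw [isBestResponse_iff] at hbest
  obtain ⟨hy, hopt⟩ := hbest
  have hx := h.2.2.1 i
  obtain ⟨r, hxy⟩ := exists_extension_of_l1Dist_eq_one hdist (by rw [hy.2, hx.2])
  have hstab : ∀ j, IsStable (G.C j) (fun e => ∑ j, s.x j e)
      (polymatroidBase (G.f j) (s.dbar j)) (s.x j) := fun j =>
    isStable_of_optimal (othersLoad_add s.x j) (G.not_canImprove_iff.mp (hno j))
  have hdbar : ∀ j, Function.update s.dbar i (s.dbar i + 1) j ≤ G.d j := by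
    intro j
    rcases eq_or_ne j i with rfl | hj
    · simpa using hi
    · simpa [Function.update_of_ne hj] using h.1 j
  have hmem : ∀ j, Function.update s.x i y j ∈
      polymatroidBase (G.f j) (Function.update s.dbar i (s.dbar i + 1) j) := by
    intro j
    rcases eq_or_ne j i with rfl | hj
    · simpa using hy
    · simpa [Function.update_of_ne hj] using h.2.2.1 j
  -- A new phase resets `L` to the loads just reached, and with it the potential; the bound grows by
  -- one full phase.
  refine ⟨hdbar, ?_, hmem, Or.inr ⟨fun e => ∑ j, s.x j e, r, fun e => ?_, fun j => ?_, ?_⟩⟩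
  · have h1 := h.2.1
    rw [← Finset.sum_erase_add _ _ (Finset.mem_univ i)] at h1 ⊢
    have h2 : ∑ j ∈ Finset.univ.erase i, Function.update s.dbar i (s.dbar i + 1) j =
        ∑ j ∈ Finset.univ.erase i, s.dbar j := Finset.sum_congr rfl fun j hj =>
      Function.update_of_ne (Finset.ne_of_mem_erase hj) _ _
    simp only [Function.update_self, h2]
    omega
  · have h1 := othersLoad_add (Function.update s.x i y) i e
    rw [othersLoad_update, Function.update_self] at h1
    have h2 := othersLoad_add s.x i e
    have h3 := hxy e
    simp only
    omega
  · rcases eq_or_ne j i with rfl | hj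
    · simpa using (hstab j).of_optimal_extension (G.regular_C j) hx (othersLoad_add s.x j) hxy hopt
    · simpa [Function.update_of_ne hj] using hstab j
  · have h1 := G.potential_le (L := fun e => ∑ j, s.x j e)
      fun j => (hmem j).2.trans_le (hdbar j)
    rw [Nat.succ_mul]
    rcases h.2.2.2 with ⟨rfl, rfl⟩ | ⟨L, r, -, -, hpot⟩ <;> simp only <;> omega

theorem Run.invariant (h : G.Run k l s) : G.Invariant k l s := by
  induction h with
  | init =>
    refine ⟨fun _ => Nat.zero_le _, by simp, fun i => ⟨fun U => by simp, by simp⟩, Or.inl ⟨rfl, rfl⟩⟩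
  | increase i _ hno _ hstep ih => exact ih.increase hno hstep
  | improve i _ hstep ih => exact ih.improve hstep

omit [DecidableEq N] in
theorem Invariant.add_le (h : G.Invariant k l s) :
    k + l ≤ Fintype.card N ^ 2 * Fintype.card E * Finset.univ.sup G.d ^ 3 := by
  rcases h.2.2.2 with ⟨rfl, rfl⟩ | ⟨L, r, -, -, hpot⟩
  · exact Nat.zero_le _
  have hk : k ≤ Fintype.card N * Finset.univ.sup G.d := by
    rw [← h.2.1]
    exact (Finset.sum_le_card_nsmul _ _ _ fun i _ =>
      (h.1 i).trans (Finset.le_sup (Finset.mem_univ i))).trans (by simp)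
  have hm : 1 ≤ Fintype.card E := Fintype.card_pos_iff.mpr ⟨r⟩
  set n := Fintype.card N
  set m := Fintype.card E
  set D := Finset.univ.sup G.d
  rcases Nat.eq_zero_or_pos (n * D) with h0 | hpos
  · have hk0 : k = 0 := by omega
    subst hk0
    simp only [zero_mul] at hpot
    omega
  have hD : 1 ≤ D := Nat.pos_of_mul_pos_left hpos
  have hmD : m * D - 1 + 1 = m * D := Nat.sub_add_cancel (Nat.mul_pos hm hD)
  -- Ranks reach only `m * D - 1`, and the spare `k * (n * D)` pays for the `k` iterations of the
  -- for-loop.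
  calc k + l ≤ k * (n * D) + k * (n * D * (m * D - 1)) := by
        have := Nat.le_mul_of_pos_right k hpos
        omega
    _ = k * (n * D * (m * D - 1 + 1)) := by ring
    _ = k * (n * D * (m * D)) := by rw [hmD]
    _ ≤ n * D * (n * D * (m * D)) := Nat.mul_le_mul_right _ hk
    _ = n ^ 2 * m * D ^ 3 := by ring

theorem Invariant.isPureNash (h : G.Invariant (∑ i, G.d i) l s)
    (hno : ∀ i, ¬ G.CanImprove s i) : G.IsPureNash s.x := by
  have hd := (Finset.sum_eq_sum_iff_of_le fun i _ => h.1 i).mp h.2.1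
  intro i
  rw [isBestResponse_iff, ← hd i (Finset.mem_univ i)]
  exact ⟨h.2.2.1 i, G.not_canImprove_iff.mp (hno i)⟩

omit [DecidableEq N] in
theorem Invariant.exists_dbar_lt (h : G.Invariant k l s) (hk : k < ∑ i, G.d i) :
    ∃ i, s.dbar i < G.d i := by
  by_contra! hcon
  have := Finset.sum_le_sum fun i (_ : i ∈ Finset.univ) => hcon i
  have := h.2.1
  omega

end PolymatroidGame

theorem mainTheorem10 {N E : Type*} [Fintype N] [DecidableEq N] [Fintype E] [DecidableEq E]
    (G : PolymatroidGame N E) :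
    -- the number of iterations (of the for-loop and of the while-loop together) is bounded
    (∀ (k l : ℕ) (s : PolymatroidGame.State N E), G.Run k l s →
      k + l ≤ Fintype.card N ^ 2 * Fintype.card E * (Finset.univ.sup G.d) ^ 3) ∧
    -- no execution gets stuck, whatever choices are made
    (∀ (k l : ℕ) (s : PolymatroidGame.State N E), G.Run k l s →
      (∀ i, G.CanImprove s i → ∃ s', G.ImproveStep i s s') ∧
      ((∀ i, ¬ G.CanImprove s i) → k < ∑ i, G.d i →
        (∃ i, s.dbar i < G.d i) ∧
        ∀ i, s.dbar i < G.d i → ∃ s', G.IncreaseStep i s s')) ∧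
    -- what is returned at the end of the for-loop is a pure Nash equilibrium
    (∀ (k l : ℕ) (s : PolymatroidGame.State N E), G.Run k l s →
      k = ∑ i, G.d i → (∀ i, ¬ G.CanImprove s i) → G.IsPureNash s.x) :=
  ⟨fun _ _ _ h => h.invariant.add_le,
    fun _ _ _ h => ⟨fun _ hi => h.invariant.exists_improveStep hi, fun hno hk =>
      ⟨h.invariant.exists_dbar_lt hk, fun i hi => h.invariant.exists_increaseStep (hno i) hi⟩⟩,
    fun _ _ _ h hk hno => (hk ▸ h.invariant : G.Invariant (∑ i, G.d i) _ _).isPureNash hno⟩
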